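/- All operators are bounded linear operators on complex Hilbert spaces; a contraction is an operator of norm at most $1$. Let \[ \mathbb E=\{(a_{11},a_{22},\det X): X=[a_{ij}]\in\mathcal M_2(\mathbb C),\ \|X\|<1\}\subset\mathbb C^3 \] be the tetrablock, $\overline{\mathbb E}$ its closure, and $b\overline{\mathbb E}=\{(x_1,x_2,x_3)\in\overline{\mathbb E}:|x_3|=1\}$ its distinguished boundary. Let $(A,B,P)$ be a commuting triple of operators on a Hilbert space $\mathcal H$, and let $\sigma_T(A,B,P)$ denote its Taylor joint spectrum. The triple is an $\mathbb E$-contraction if $\overline{\mathbb E}$ is a spectral set for it, that is, $\sigma_T(A,B,P)\subseteq\overline{\mathbb E}$ and $\|p(A,B,P)\,q(A,B,P)^{-1}\|\le\sup_{z\in\overline{\mathbb E}}|p(z)/q(z)|$ for all $p,q\in\mathbb C[z_1,z_2,z_3]$ such that $q$ has no zero in $\overline{\mathbb E}$ (in which case $q(A,B,P)$ is invertible). It is an $\mathbb E$-unitary if $A,B,P$ are normal and $\sigma_T(A,B,P)\subseteq b\overline{\mathbb E}$. It is an $\mathbb E$-isometry if there are a Hilbert space $\mathcal K\supseteq\mathcal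 H$ and an $\mathbb E$-unitary $(Q_1,Q_2,V)$ on $\mathcal K$ such that $\mathcal H$ is invariant under $Q_1,Q_2,V$ and $(Q_1|_{\mathcal H},Q_2|_{\mathcal H},V|_{\mathcal H})=(A,B,P)$. It is a triangular $\mathbb E$-unitary (respectively, a triangular $\mathbb E$-isometry) if it is an $\mathbb E$-contraction, is an $\mathbb E$-unitary (respectively, an $\mathbb E$-isometry), and is of the form $(S,T,ST)$ for a pair of commuting contractions $S,T$. Lemma. Let $(A,B,P)$ be a commuting triple of contractions on a Hilbert space. Then (a) $(A,B,P)$ is a triangular $\mathbb E$-unitary if and only if $(A,B,P)=(S,T,ST)$ for a pair of commuting unitaries $S,T$; (b) $(A,B,P)$ is a triangular $\mathbb E$-isometry if and only if $(A,B,P)=(S,T,ST)$ for a pair of commuting isometries $S,T$. -/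

import Mathlib

universe u

noncomputable section

namespace Tetrablock

/-- The tetrablock: all points `(a₁₁, a₂₂, det A)` of `ℂ³`, where `A` is a complex `2 × 2` matrix
whose operator norm, with respect to the Euclidean norm of `ℂ²`, is less than one. -/
def tetrablock : Set (Fin 3 → ℂ) :=
  {x | ∃ A : Matrix (Fin 2) (Fin 2) ℂ,
    ‖Matrix.toEuclideanCLM (𝕜 := ℂ) A‖ < 1 ∧ x = ![A 0 0, A 1 1, A.det]}

/-- The closed tetrablock. -/
def closedTetrablock : Set (Fin 3 → ℂ) := closure tetrablock

/-- The distinguished boundary of the tetrablock: the points of the closed tetrablock whose last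
coordinate is unimodular. -/
def distinguishedBoundary : Set (Fin 3 → ℂ) := {x | x ∈ closedTetrablock ∧ ‖x 2‖ = 1}

variable {H : Type u} [NormedAddCommGroup H] [InnerProductSpace ℂ H]

/-- `A`, `B`, `P` commute pairwise. -/
def CommutingTriple (A B P : H →L[ℂ] H) : Prop := Commute A B ∧ Commute A P ∧ Commute B P

section Koszul

/-- The Koszul differential from degree zero to degree one, `x ↦ (A x, B x, P x)`, in the
coordinates `e₁, e₂, e₃` of the exterior algebra. -/
def koszul₀ (A B P : H →L[ℂ] H) : H →L[ℂ] H × H × H := A.prod (B.prod P)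

/-- The Koszul differential from degree one to degree two,
`(x₁, x₂, x₃) ↦ (A x₂ - B x₁, A x₃ - P x₁, B x₃ - P x₂)`, in the coordinates
`e₁ ∧ e₂, e₁ ∧ e₃, e₂ ∧ e₃`. -/
def koszul₁ (A B P : H →L[ℂ] H) : H × H × H →L[ℂ] H × H × H :=
  let x₁ := ContinuousLinearMap.fst ℂ H (H × H)
  let x₂ := (ContinuousLinearMap.fst ℂ H H).comp (ContinuousLinearMap.snd ℂ H (H × H))
  let x₃ := (ContinuousLinearMap.snd ℂ H H).comp (ContinuousLinearMap.snd ℂ H (H × H))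
  (A.comp x₂ - B.comp x₁).prod ((A.comp x₃ - P.comp x₁).prod (B.comp x₃ - P.comp x₂))

/-- The Koszul differential from degree two to degree three,
`(y₁₂, y₁₃, y₂₃) ↦ A y₂₃ - B y₁₃ + P y₁₂`. -/
def koszul₂ (A B P : H →L[ℂ] H) : H × H × H →L[ℂ] H :=
  let y₁₂ := ContinuousLinearMap.fst ℂ H (H × H)
  let y₁₃ := (ContinuousLinearMap.fst ℂ H H).comp (ContinuousLinearMap.snd ℂ H (H × H))
  let y₂₃ := (ContinuousLinearMap.snd ℂ H H).comp (ContinuousLinearMap.snd ℂ H (H × H))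
  A.comp y₂₃ - B.comp y₁₃ + P.comp y₁₂

/-- The Koszul complex `0 → H → H³ → H³ → H → 0` of the triple `(A, B, P)` is exact. -/
def KoszulExact (A B P : H →L[ℂ] H) : Prop :=
  Function.Injective (koszul₀ A B P) ∧
  Function.Exact (koszul₀ A B P) (koszul₁ A B P) ∧
  Function.Exact (koszul₁ A B P) (koszul₂ A B P) ∧
  Function.Surjective (koszul₂ A B P)

end Koszul

/-- The Taylor joint spectrum of a (commuting) triple `(A, B, P)`: the points `z` of `ℂ³` such
that the Koszul complex of `(A - z₁, B - z₂, P - z₃)` is not exact. -/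
def taylorSpectrum (A B P : H →L[ℂ] H) : Set (Fin 3 → ℂ) :=
  {z | ¬ KoszulExact (A - z 0 • 1) (B - z 1 • 1) (P - z 2 • 1)}

/-- The value `p(A, B, P)` of a polynomial in three variables at a (commuting) triple. -/
def polyEval (p : MvPolynomial (Fin 3) ℂ) (A B P : H →L[ℂ] H) : H →L[ℂ] H :=
  ∑ m ∈ p.support, p.coeff m • (A ^ m 0 * B ^ m 1 * P ^ m 2)

/-- The supremum of `|p / q|` over the closed tetrablock. -/
def ratSup (p q : MvPolynomial (Fin 3) ℂ) : ℝ :=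
  sSup ((fun z => ‖MvPolynomial.eval z p / MvPolynomial.eval z q‖) '' closedTetrablock)

/-- `(A, B, P)` is an `𝔼`-contraction: a commuting triple for which the closed tetrablock is a
spectral set, that is, its Taylor joint spectrum lies in the closed tetrablock, and for every
rational function `p / q` whose denominator has no zero in the closed tetrablock, `q(A, B, P)` is
invertible and `‖p(A, B, P) q(A, B, P)⁻¹‖ ≤ sup |p / q|` over the closed tetrablock. -/
def IsEContraction (A B P : H →L[ℂ] H) : Prop :=
  CommutingTriple A B P ∧
  taylorSpectrum A B P ⊆ closedTetrablock ∧
  ∀ p q : MvPolynomial (Fin 3) ℂ, (∀ z ∈ closedTetrablock, MvPolynomial.eval z q ≠ 0) →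
    IsUnit (polyEval q A B P) ∧
    ‖polyEval p A B P * Ring.inverse (polyEval q A B P)‖ ≤ ratSup p q

/-- `(A, B, P)` is an `𝔼`-unitary: commuting normal operators whose Taylor joint spectrum lies in
the distinguished boundary of the tetrablock. -/
def IsEUnitary [CompleteSpace H] (A B P : H →L[ℂ] H) : Prop :=
  CommutingTriple A B P ∧ IsStarNormal A ∧ IsStarNormal B ∧ IsStarNormal P ∧
  taylorSpectrum A B P ⊆ distinguishedBoundary

/-- `(A, B, P)` is an `𝔼`-isometry: a commuting triple that is the restriction of an `𝔼`-unitary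
on a larger Hilbert space `K` to `H`, embedded by `ι` as a joint invariant subspace. -/
def IsEIsometry (A B P : H →L[ℂ] H) : Prop :=
  CommutingTriple A B P ∧
  ∃ (K : Type u) (_ : NormedAddCommGroup K) (_ : InnerProductSpace ℂ K) (_ : CompleteSpace K)
    (ι : H →ₗᵢ[ℂ] K) (Q₁ Q₂ V : K →L[ℂ] K), IsEUnitary Q₁ Q₂ V ∧
    ∀ x : H, Q₁ (ι x) = ι (A x) ∧ Q₂ (ι x) = ι (B x) ∧ V (ι x) = ι (P x)

/-- The triple `(A, B, P)` is of the form `(S, T, S T)` for commuting contractions `S`, `T`. -/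
def IsTriangularForm (A B P : H →L[ℂ] H) : Prop :=
  ∃ S T : H →L[ℂ] H, Commute S T ∧ ‖S‖ ≤ 1 ∧ ‖T‖ ≤ 1 ∧ (A, B, P) = (S, T, S * T)

/-- A triangular `𝔼`-unitary: an `𝔼`-contraction that is an `𝔼`-unitary of triangular form. -/
def IsTriangularEUnitary [CompleteSpace H] (A B P : H →L[ℂ] H) : Prop :=
  IsEContraction A B P ∧ IsEUnitary A B P ∧ IsTriangularForm A B P

/-- A triangular `𝔼`-isometry: an `𝔼`-contraction that is an `𝔼`-isometry of triangular form. -/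
def IsTriangularEIsometry (A B P : H →L[ℂ] H) : Prop :=
  IsEContraction A B P ∧ IsEIsometry A B P ∧ IsTriangularForm A B P

end Tetrablock

end

namespace Tetrablock

/-! ### Points `(s, t, st)` of the closed tetrablock, and its compactness. -/

section Geometry

/-! For commuting contractions, everything is decided by the product `S T`. If it is isometric, then
`‖x‖ = ‖S T x‖ ≤ ‖T x‖ ≤ ‖x‖`, so `T` is isometric, and by commutation so is `S`; if it is also
onto, both are unitary. It remains to see that the last entry of an `𝔼`-unitary is unitary
(`IsEUnitary.mem_unitary`): characters of a commutative C⋆-algebra containing the triple give points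
of the Taylor spectrum, where the third coordinate is unimodular. Restriction then makes the last
entry of an `𝔼`-isometry isometric.

Conversely, a Bézout identity confines the Taylor spectrum of `(S, T, S T)` to points `(s, t, st)`
with `s`, `t` in the two spectra. Commuting isometries extend to commuting unitaries
(`exists_commuting_unitary_extension`), where Gelfand theory gives the von Neumann inequality; the
inequality passes to the invariant subspace (`isEContraction_of_extension`). -/

lemma mem_tetrablock_of_norm_lt_one {s t : ℂ} (hs : ‖s‖ < 1) (ht : ‖t‖ < 1) :
    ![s, t, s * t] ∈ tetrablock := by
  refine ⟨Matrix.diagonal ![s, t], ?_, by simp⟩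
  rw [← Matrix.cstar_norm_def, Matrix.l2_opNorm_diagonal, pi_norm_lt_iff one_pos]
  intro i
  fin_cases i <;> simpa

lemma mem_closedTetrablock_of_norm_le_one {s t : ℂ} (hs : ‖s‖ ≤ 1) (ht : ‖t‖ ≤ 1) :
    ![s, t, s * t] ∈ closedTetrablock := by
  have hs' : s ∈ closure (Metric.ball (0 : ℂ) 1) := by
    simpa [closure_ball (0 : ℂ) one_ne_zero] using hs
  have ht' : t ∈ closure (Metric.ball (0 : ℂ) 1) := by
    simpa [closure_ball (0 : ℂ) one_ne_zero] using ht
  have hcont : Continuous fun p : ℂ × ℂ => (![p.1, p.2, p.1 * p.2] : Fin 3 → ℂ) := by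
    refine continuous_pi fun i => ?_
    fin_cases i <;> simp <;> fun_prop
  refine map_mem_closure (x := (s, t)) hcont 
    (t := tetrablock) (s := Metric.ball (0 : ℂ) 1 ×ˢ Metric.ball (0 : ℂ) 1)
    (by rw [closure_prod_eq]; exact ⟨hs', ht'⟩) ?_
  rintro ⟨a, b⟩ ⟨ha, hb⟩
  exact mem_tetrablock_of_norm_lt_one (by simpa using ha) (by simpa using hb)

lemma norm_apply_le_norm_toEuclideanCLM (A : Matrix (Fin 2) (Fin 2) ℂ) (i j : Fin 2) :
    ‖A i j‖ ≤ ‖Matrix.toEuclideanCLM (𝕜 := ℂ) A‖ := by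
  have h := (Matrix.toEuclideanCLM (𝕜 := ℂ) A).le_opNorm (EuclideanSpace.single j 1)
  rw [PiLp.norm_single, norm_one, mul_one] at h
  have h' := PiLp.norm_apply_le (Matrix.toEuclideanCLM (𝕜 := ℂ) A (EuclideanSpace.single j 1)) i
  have : (Matrix.toEuclideanCLM (𝕜 := ℂ) A (EuclideanSpace.single j 1)) i = A i j := by
    simp [EuclideanSpace.single]
  rw [this] at h'
  exact h'.trans h

lemma isBounded_tetrablock : Bornology.IsBounded tetrablock := by
  refine (Metric.isBounded_closedBall (x := (0 : Fin 3 → ℂ)) (r := 2)).subset ?_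
  rintro _ ⟨A, hA, rfl⟩
  have h : ∀ i j, ‖A i j‖ ≤ 1 := fun i j =>
    (norm_apply_le_norm_toEuclideanCLM A i j).trans hA.le
  rw [mem_closedBall_zero_iff, pi_norm_le_iff_of_nonneg zero_le_two]
  have hdet : ‖A.det‖ ≤ 2 := by
    rw [Matrix.det_fin_two]
    calc _ ≤ ‖A 0 0‖ * ‖A 1 1‖ + ‖A 0 1‖ * ‖A 1 0‖ := by
          simpa only [norm_mul] using norm_sub_le (A 0 0 * A 1 1) (A 0 1 * A 1 0)
      _ ≤ 1 * 1 + 1 * 1 := by gcongr <;> apply h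
      _ = 2 := by norm_num
  intro i
  fin_cases i
  · simpa using (h 0 0).trans one_le_two
  · simpa using (h 1 1).trans one_le_two
  · simpa using hdet

lemma isCompact_closedTetrablock : IsCompact closedTetrablock :=
  isBounded_tetrablock.isCompact_closure

/-- Compactness makes `ratSup` a true supremum: `sSup` of an unbounded set of reals would be `0`. -/
lemma norm_div_le_ratSup {p q : MvPolynomial (Fin 3) ℂ}
    (hq : ∀ z ∈ closedTetrablock, MvPolynomial.eval z q ≠ 0) {z : Fin 3 → ℂ}
    (hz : z ∈ closedTetrablock) :
    ‖MvPolynomial.eval z p / MvPolynomial.eval z q‖ ≤ ratSup p q := by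
  refine le_csSup (isCompact_closedTetrablock.bddAbove_image ?_) ⟨z, hz, rfl⟩
  exact ((MvPolynomial.continuous_eval p).continuousOn.div
    (MvPolynomial.continuous_eval q).continuousOn hq).norm

lemma ratSup_nonneg (p q : MvPolynomial (Fin 3) ℂ) : 0 ≤ ratSup p q :=
  Real.sSup_nonneg <| by rintro _ ⟨z, -, rfl⟩; exact norm_nonneg _

end Geometry

/-! ### Exactness of the Koszul complex and the Taylor spectrum of `(S, T, S T)`. -/

section Koszul

variable {H : Type u} [NormedAddCommGroup H] [InnerProductSpace ℂ H]

@[simp]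
lemma koszul₀_apply (A B P : H →L[ℂ] H) (x : H) : koszul₀ A B P x = (A x, B x, P x) := rfl

@[simp]
lemma koszul₁_apply (A B P : H →L[ℂ] H) (x : H × H × H) :
    koszul₁ A B P x = (A x.2.1 - B x.1, A x.2.2 - P x.1, B x.2.2 - P x.2.1) := rfl

@[simp]
lemma koszul₂_apply (A B P : H →L[ℂ] H) (y : H × H × H) :
    koszul₂ A B P y = A y.2.2 - B y.2.1 + P y.1 := rfl

/-- The Koszul complex of a commuting triple is exact if the triple satisfies a Bézout identity
with coefficients that commute with it. -/
lemma koszulExact_of_bezout {A B P U V W : H →L[ℂ] H} (h : CommutingTriple A B P)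
    (hUA : Commute U A) (hUB : Commute U B) (hUP : Commute U P)
    (hVA : Commute V A) (hVB : Commute V B) (hVP : Commute V P)
    (hWA : Commute W A) (hWB : Commute W B) (hWP : Commute W P)
    (hone : U * A + V * B + W * P = 1) : KoszulExact A B P := by
  obtain ⟨hAB, hAP, hBP⟩ := h
  have ap {X Y : H →L[ℂ] H} (h : Commute X Y) (x : H) : X (Y x) = Y (X x) :=
    DFunLike.congr_fun h.eq x
  have one (x : H) : U (A x) + V (B x) + W (P x) = x := DFunLike.congr_fun hone x
  -- Contraction by `(U, V, W)` is a homotopy from `U A + V B + W P = 1` to zero; every preimage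
  -- chosen below is the contraction of the given element.
  refine ⟨(injective_iff_map_eq_zero _).2 fun x hx => ?_, ?_, ?_, ?_⟩
  · simp only [koszul₀_apply, Prod.mk_eq_zero] at hx
    rw [← one x, hx.1, hx.2.1, hx.2.2]
    simp
  · rintro ⟨x, y, z⟩
    simp only [koszul₁_apply, Prod.mk_eq_zero, sub_eq_zero, Set.mem_range, koszul₀_apply,
      Prod.mk.injEq]
    refine ⟨fun ⟨h1, h2, h3⟩ => ⟨U x + V y + W z, ?_⟩, ?_⟩
    · simp only [map_add, ← ap hUA, ← ap hVA, ← ap hWA, ← ap hUB, ← ap hVB, ← ap hWB, ← ap hUP,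
        ← ap hVP, ← ap hWP]
      refine ⟨?_, ?_, ?_⟩
      · rw [h1, h2, one]
      · rw [← h1, h3, one]
      · rw [← h2, ← h3, one]
    · rintro ⟨w, rfl, rfl, rfl⟩
      exact ⟨ap hAB w, ap hAP w, ap hBP w⟩
  · rintro ⟨x, y, z⟩
    simp only [koszul₁_apply, koszul₂_apply, Set.mem_range, Prod.exists, Prod.mk.injEq]
    refine ⟨fun h => ⟨-(V x + W y), U x - W z, U y + V z, ?_⟩, ?_⟩
    · simp only [map_add, map_sub, map_neg, ← ap hUA, ← ap hVA, ← ap hWA, ← ap hUB, ← ap hVB,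
        ← ap hWB, ← ap hUP, ← ap hVP, ← ap hWP]
      have hU := congrArg U h
      have hV := congrArg V h
      have hW := congrArg W h
      simp only [map_add, map_sub, map_zero] at hU hV hW
      refine ⟨?_, ?_, ?_⟩
      · refine Eq.trans ?_ (one x)
        rw [← sub_zero (U (A x) + V (B x) + W (P x)), ← hW]
        abel
      · refine Eq.trans ?_ (one y)
        rw [← add_zero (U (A y) + V (B y) + W (P y)), ← hV]
        abel
      · refine Eq.trans ?_ (one z)
        rw [← sub_zero (U (A z) + V (B z) + W (P z)), ← hU]
        abel
    · rintro ⟨a, b, c, rfl, rfl, rfl⟩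
      simp only [map_sub, ap hAB, ap hAP, ap hBP]
      abel
  · intro x
    refine ⟨(W x, -V x, U x), ?_⟩
    simp only [koszul₂_apply, map_neg, sub_neg_eq_add, ← ap hUA, ← ap hVB, ← ap hWP]
    exact one x

lemma koszulExact_of_isUnit_fst {A B P : H →L[ℂ] H} (h : CommutingTriple A B P)
    (hA : IsUnit A) : KoszulExact A B P := by
  obtain ⟨a, rfl⟩ := hA
  refine koszulExact_of_bezout (U := ↑a⁻¹) (V := 0) (W := 0) h ?_ h.1.units_inv_left
    h.2.1.units_inv_left (.zero_left _) (.zero_left _) (.zero_left _) (.zero_left _)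
    (.zero_left _) (.zero_left _) (by simp)
  exact (Commute.refl _).units_inv_left

lemma koszulExact_of_isUnit_snd {A B P : H →L[ℂ] H} (h : CommutingTriple A B P)
    (hB : IsUnit B) : KoszulExact A B P := by
  obtain ⟨b, rfl⟩ := hB
  refine koszulExact_of_bezout (U := 0) (V := ↑b⁻¹) (W := 0) h (.zero_left _) (.zero_left _)
    (.zero_left _) h.1.symm.units_inv_left ?_ h.2.2.units_inv_left (.zero_left _)
    (.zero_left _) (.zero_left _) (by simp)
  exact (Commute.refl _).units_inv_left

lemma CommutingTriple.sub_smul_one {A B P : H →L[ℂ] H} (h : CommutingTriple A B P)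
    (a b c : ℂ) : CommutingTriple (A - a • 1) (B - b • 1) (P - c • 1) := by
  have key {X Y : H →L[ℂ] H} (hXY : Commute X Y) (x y : ℂ) :
      Commute (X - x • 1) (Y - y • 1) :=
    (hXY.sub_right ((Commute.one_right X).smul_right y)).sub_left
      ((Commute.one_left _).smul_left x)
  exact ⟨key h.1 a b, key h.2.1 a c, key h.2.2 b c⟩

lemma commutingTriple_mul {S T : H →L[ℂ] H} (h : Commute S T) : CommutingTriple S T (S * T) :=
  ⟨h, (Commute.refl S).mul_right h, h.symm.mul_right (.refl T)⟩

/-- The Taylor joint spectrum of `(S, T, S T)` consists of points `(s, t, s t)` with `s` and `t`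
in the spectra of `S` and `T`. -/
lemma mem_spectrum_of_mem_taylorSpectrum_mul {S T : H →L[ℂ] H} (h : Commute S T)
    {z : Fin 3 → ℂ} (hz : z ∈ taylorSpectrum S T (S * T)) :
    z 0 ∈ spectrum ℂ S ∧ z 1 ∈ spectrum ℂ T ∧ z 2 = z 0 * z 1 := by
  have h3 := (commutingTriple_mul h).sub_smul_one (z 0) (z 1) (z 2)
  refine ⟨fun hS => hz (koszulExact_of_isUnit_fst h3 ?_),
    fun hT => hz (koszulExact_of_isUnit_snd h3 ?_), ?_⟩
  · rw [spectrum.mem_resolventSet_iff, Algebra.algebraMap_eq_smul_one] at hS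
    simpa using hS.neg
  · rw [spectrum.mem_resolventSet_iff, Algebra.algebraMap_eq_smul_one] at hT
    simpa using hT.neg
  · by_contra hne
    have hd : z 0 * z 1 - z 2 ≠ 0 := sub_ne_zero.2 (Ne.symm hne)
    set d := (z 0 * z 1 - z 2)⁻¹ with hd_def
    have hsmul (c : ℂ) (X : H →L[ℂ] H) : Commute (c • (1 : H →L[ℂ] H)) X :=
      (Commute.one_left X).smul_left c
    have hT {X : H →L[ℂ] H} (hX : Commute T X) (c : ℂ) : Commute (-d • T) (X - c • 1) :=
      (hX.sub_right ((Commute.one_right T).smul_right c)).smul_left _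
    -- The coefficients come from `z₀ z₁ - z₂ = (S T - z₂) - T (S - z₀) - z₀ (T - z₁)`, divided by
    -- the nonzero left side.
    refine hz (koszulExact_of_bezout (U := -d • T) (V := (-d * z 0) • 1) (W := d • 1) h3
      (hT h.symm _) (hT (.refl T) _) (hT (h.symm.mul_right (.refl T)) _)
      (hsmul _ _) (hsmul _ _) (hsmul _ _) (hsmul _ _) (hsmul _ _) (hsmul _ _) ?_)
    have hone : d * (z 0 * z 1 - z 2) = 1 := inv_mul_cancel₀ hd
    calc _ = (d * (z 0 * z 1 - z 2)) • (1 : H →L[ℂ] H) := by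
          simp only [smul_mul_assoc, mul_sub, one_mul, mul_smul_comm, mul_one, h.eq]
          module
      _ = 1 := by rw [hone, one_smul]

end Koszul

/-! ### Commutative subalgebras containing a commuting family. -/

section Commutative

/-- Pairwise commuting elements of a complex Banach algebra lie in a commutative closed
subalgebra. -/
lemma exists_normedCommRing_of_pairwise_commute {𝒜 : Type u} [NormedRing 𝒜] [NormedAlgebra ℂ 𝒜]
    [CompleteSpace 𝒜] {s : Set 𝒜} (hs : ∀ a ∈ s, ∀ b ∈ s, a * b = b * a) :
    ∃ (C : Type u) (_ : NormedCommRing C) (_ : NormedAlgebra ℂ C) (_ : CompleteSpace C)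
      (φ : C →ₐ[ℂ] 𝒜), (∀ c, ‖φ c‖ = ‖c‖) ∧ ∀ a ∈ s, ∃ c, φ c = a := by
  -- The double centralizer of a commuting set is commutative, and it is closed like every
  -- centralizer.
  let S : Subalgebra ℂ 𝒜 := Subalgebra.centralizer ℂ (Subalgebra.centralizer ℂ s : Set 𝒜)
  have hS : IsClosed (S : Set 𝒜) := Set.isClosed_centralizer _
  have hcomm (x y : S) : x * y = y * x :=
    Subtype.ext <| Set.centralizer_centralizer_comm_of_comm hs _ x.2 _ y.2
  let _ : NormedCommRing S := { (inferInstance : NormedRing S) with mul_comm := hcomm }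
  exact ⟨S, inferInstance, inferInstance, hS.completeSpace_coe, S.val, fun _ => rfl,
    fun a ha => ⟨⟨a, Set.subset_centralizer_centralizer ha⟩, rfl⟩⟩

/-- Pairwise commuting normal elements of a C⋆-algebra lie in a commutative C⋆-subalgebra, which
is closed under inversion. -/
lemma exists_commCStarAlgebra_of_pairwise_commute {𝒜 : Type u} [CStarAlgebra 𝒜] {s : Set 𝒜}
    (hs : ∀ a ∈ s, ∀ b ∈ s, Commute a b) (hn : ∀ a ∈ s, IsStarNormal a) :
    ∃ (C : Type u) (_ : CommCStarAlgebra C) (φ : C →⋆ₐ[ℂ] 𝒜), (∀ c, ‖φ c‖ = ‖c‖) ∧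
      (∀ a ∈ s, ∃ c, φ c = a) ∧ ∀ c, IsUnit (φ c) → IsUnit c := by
  let S : StarSubalgebra ℂ 𝒜 :=
    StarSubalgebra.centralizer ℂ (StarSubalgebra.centralizer ℂ s : Set 𝒜)
  have hSc : (S : Set 𝒜) = (s ∪ star s).centralizer.centralizer :=
    StarSubalgebra.coe_centralizer_centralizer ℂ s
  have hS : IsClosed (S : Set 𝒜) := hSc ▸ Set.isClosed_centralizer _
  have hs' : ∀ a ∈ s ∪ star s, ∀ b ∈ s ∪ star s, a * b = b * a := by
    -- Fuglede's theorem: what commutes with a normal element commutes with its adjoint.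
    have h1 : ∀ a ∈ s, ∀ b ∈ star s, Commute a b := fun a ha b hb => by
      simpa using (hn _ hb).commute_star_right (hs a ha _ hb)
    rintro a (ha | ha) b (hb | hb)
    · exact hs a ha b hb
    · exact h1 a ha b hb
    · exact (h1 b hb a ha).symm
    · simpa using (hs _ ha _ hb).star_star.eq
  have hcomm (x y : S) : x * y = y * x :=
    Subtype.ext <| Set.centralizer_centralizer_comm_of_comm hs' _ (hSc ▸ x.2) _ (hSc ▸ y.2)
  let _ : CStarAlgebra S := inferInstance
  let _ : CommCStarAlgebra S := { (inferInstance : CStarAlgebra S) with mul_comm := hcomm }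
  refine ⟨S, inferInstance, S.subtype, fun _ => rfl, fun a ha => ⟨⟨a, ?_⟩, rfl⟩,
    fun c hc => (StarSubalgebra.coe_isUnit S).1 hc⟩
  rw [← SetLike.mem_coe, hSc]
  exact Set.subset_centralizer_centralizer (Or.inl ha)

end Commutative
open WeakDual

/-! ### The closed tetrablock as a spectral set. -/

section SpectralSet

variable {H : Type u} [NormedAddCommGroup H] [InnerProductSpace ℂ H]

/-- Moves polynomial calculus into a commutative algebra, where characters apply. -/
lemma polyEval_map {C : Type*} [CommRing C] [Algebra ℂ C] (φ : C →ₐ[ℂ] (H →L[ℂ] H))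
    (p : MvPolynomial (Fin 3) ℂ) (a b c : C) :
    polyEval p (φ a) (φ b) (φ c) = φ (MvPolynomial.aeval ![a, b, c] p) := by
  rw [MvPolynomial.aeval_def, MvPolynomial.eval₂_eq', map_sum, polyEval]
  refine Finset.sum_congr rfl fun m _ => ?_
  simp [Fin.prod_univ_three, Algebra.smul_def]

lemma character_aeval {C : Type*} [CommRing C] [Algebra ℂ C] (χ : C →ₐ[ℂ] ℂ)
    (p : MvPolynomial (Fin 3) ℂ) (a b : C) :
    χ (MvPolynomial.aeval ![a, b, a * b] p) =
      MvPolynomial.eval ![χ a, χ b, χ a * χ b] p := by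
  rw [← AlgHom.comp_apply, MvPolynomial.comp_aeval, MvPolynomial.aeval_eq_eval]
  congr 2
  ext i
  fin_cases i <;> simp

/-- Asking only `‖1‖ ≤ 1` keeps the zero Hilbert space, where `‖1‖ = 0`. -/
lemma norm_le_one_of_mem_spectrum {C : Type*} [NormedRing C] [NormedAlgebra ℂ C]
    [CompleteSpace C] (hone : ‖(1 : C)‖ ≤ 1) {c : C} (hc : ‖c‖ ≤ 1) {z : ℂ}
    (hz : z ∈ spectrum ℂ c) : ‖z‖ ≤ 1 :=
  (spectrum.norm_le_norm_mul_of_mem hz).trans (mul_le_one₀ hc (norm_nonneg _) hone)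

/-- Polynomials without zeros on the closed tetrablock are invertible at `(S, T, S T)`. -/
lemma isUnit_polyEval [CompleteSpace H] {S T : H →L[ℂ] H} (h : Commute S T) (hS : ‖S‖ ≤ 1)
    (hT : ‖T‖ ≤ 1) {q : MvPolynomial (Fin 3) ℂ}
    (hq : ∀ z ∈ closedTetrablock, MvPolynomial.eval z q ≠ 0) :
    IsUnit (polyEval q S T (S * T)) := by
  obtain ⟨C, _, _, _, φ, hφ, hmem⟩ := exists_normedCommRing_of_pairwise_commute (s := {S, T}) (by
    rintro a (rfl | rfl) b (rfl | rfl)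
    exacts [rfl, h.eq, h.symm.eq, rfl])
  obtain ⟨a, rfl⟩ := hmem S (.inl rfl)
  obtain ⟨b, rfl⟩ := hmem T (.inr rfl)
  rw [← map_mul, polyEval_map]
  refine .map φ ?_
  -- A non-unit is killed by some character `χ`, so `q` would vanish at `(χ a, χ b, χ a χ b)`, a
  -- point of the closed tetrablock.
  by_contra hunit
  obtain ⟨χ, hχ⟩ := CharacterSpace.exists_apply_eq_zero hunit
  have hone : ‖(1 : C)‖ ≤ 1 := by
    rw [← hφ, map_one]
    exact ContinuousLinearMap.norm_id_le
  have hle (c : C) (hc : ‖φ c‖ ≤ 1) : ‖χ c‖ ≤ 1 :=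
    norm_le_one_of_mem_spectrum hone (hφ c ▸ hc) (AlgHom.apply_mem_spectrum χ c)
  refine hq _ (mem_closedTetrablock_of_norm_le_one (hle a hS) (hle b hT)) ?_
  rw [← hχ]
  exact (character_aeval (CharacterSpace.toAlgHom χ) q a b).symm

/-- The von Neumann inequality on the closed tetrablock for `(S, T, S T)` with `S` and `T`
commuting normal contractions. -/
lemma norm_polyEval_mul_inverse_le [CompleteSpace H] {S T : H →L[ℂ] H} (h : Commute S T)
    (hS : ‖S‖ ≤ 1) (hT : ‖T‖ ≤ 1) (hSn : IsStarNormal S) (hTn : IsStarNormal T)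
    {p q : MvPolynomial (Fin 3) ℂ}
    (hq : ∀ z ∈ closedTetrablock, MvPolynomial.eval z q ≠ 0) :
    ‖polyEval p S T (S * T) * Ring.inverse (polyEval q S T (S * T))‖ ≤ ratSup p q := by
  have hqu := isUnit_polyEval h hS hT hq
  obtain ⟨C, _, φ, hφ, hmem, hunit⟩ := exists_commCStarAlgebra_of_pairwise_commute (s := {S, T})
    (by
      rintro a (rfl | rfl) b (rfl | rfl)
      exacts [rfl, h, h.symm, rfl])
    (by rintro a (rfl | rfl) <;> assumption)
  obtain ⟨a, rfl⟩ := hmem S (.inl rfl)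
  obtain ⟨b, rfl⟩ := hmem T (.inr rfl)
  have hpoly (r : MvPolynomial (Fin 3) ℂ) : polyEval r (φ a) (φ b) (φ a * φ b) =
      φ (MvPolynomial.aeval ![a, b, a * b] r) := by
    rw [← map_mul]
    exact polyEval_map φ.toAlgHom r a b (a * b)
  rw [hpoly] at hqu
  obtain ⟨u, hu⟩ := hunit _ hqu
  have hinv : Ring.inverse (φ u) = φ ↑u⁻¹ :=
    Ring.inverse_unit (Units.map (φ : C →* (H →L[ℂ] H)) u)
  -- The Gelfand transform is isometric, so it suffices to bound each character value, which is `p /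
  -- q` at a point of the closed tetrablock.
  rw [hpoly, hpoly, ← hu, hinv, ← map_mul, hφ,
    ← (AddMonoidHomClass.isometry_iff_norm _).1 (gelfandTransform_isometry C),
    ContinuousMap.norm_le _ (ratSup_nonneg p q)]
  intro χ
  have hone : ‖(1 : C)‖ ≤ 1 := by
    rw [← hφ, map_one]
    exact ContinuousLinearMap.norm_id_le
  have hle (c : C) (hc : ‖φ c‖ ≤ 1) : ‖χ c‖ ≤ 1 :=
    norm_le_one_of_mem_spectrum hone (hφ c ▸ hc) (AlgHom.apply_mem_spectrum χ c)
  have hχ (r : MvPolynomial (Fin 3) ℂ) : χ (MvPolynomial.aeval ![a, b, a * b] r) =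
      MvPolynomial.eval ![χ a, χ b, χ a * χ b] r :=
    character_aeval (CharacterSpace.toAlgHom χ) r a b
  have hz := mem_closedTetrablock_of_norm_le_one (hle a hS) (hle b hT)
  have hinv' : χ ↑u⁻¹ * χ (u : C) = 1 := by rw [← map_mul, Units.inv_mul, map_one]
  have hval : χ (MvPolynomial.aeval ![a, b, a * b] p * ↑u⁻¹) =
      MvPolynomial.eval ![χ a, χ b, χ a * χ b] p / MvPolynomial.eval ![χ a, χ b, χ a * χ b] q := by
    rw [map_mul, hχ, eq_div_iff (hq _ hz), mul_assoc, ← hχ q, ← hu, hinv',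
      mul_one]
  rw [gelfandTransform_apply_apply, hval]
  exact norm_div_le_ratSup hq hz

/-- A triple `(S, T, S T)` of commuting contractions is an `𝔼`-contraction as soon as it extends
to such a triple of commuting normal contractions. -/
lemma isEContraction_of_extension [CompleteSpace H] {K : Type u} [NormedAddCommGroup K]
    [InnerProductSpace ℂ K] [CompleteSpace K] (ι : H →ₗᵢ[ℂ] K) {S T : H →L[ℂ] H}
    {U V : K →L[ℂ] K} (h : Commute S T) (hS : ‖S‖ ≤ 1) (hT : ‖T‖ ≤ 1) (hUV : Commute U V)
    (hU : ‖U‖ ≤ 1) (hV : ‖V‖ ≤ 1) (hUn : IsStarNormal U) (hVn : IsStarNormal V)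
    (hSU : ∀ x, U (ι x) = ι (S x)) (hTV : ∀ x, V (ι x) = ι (T x)) :
    IsEContraction S T (S * T) := by
  refine ⟨commutingTriple_mul h, fun z hz => ?_, fun p q hq => ?_⟩
  · obtain ⟨h0, h1, h2⟩ := mem_spectrum_of_mem_taylorSpectrum_mul h hz
    have hone : ‖(1 : H →L[ℂ] H)‖ ≤ 1 := ContinuousLinearMap.norm_id_le
    have hz' : z = ![z 0, z 1, z 0 * z 1] := by
      ext i
      fin_cases i <;> simp [h2]
    rw [hz']
    exact mem_closedTetrablock_of_norm_le_one (norm_le_one_of_mem_spectrum hone hS h0)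
      (norm_le_one_of_mem_spectrum hone hT h1)
  · refine ⟨isUnit_polyEval h hS hT hq, ?_⟩
    have hpow {X : H →L[ℂ] H} {Y : K →L[ℂ] K} (hXY : ∀ x, Y (ι x) = ι (X x)) (n : ℕ) (x : H) :
        (Y ^ n) (ι x) = ι ((X ^ n) x) := by
      induction n generalizing x with
      | zero => rfl
      | succ n ih => rw [pow_succ, pow_succ, mul_apply_eq_comp, hXY, ih]; rfl
    have hpoly (r : MvPolynomial (Fin 3) ℂ) (x : H) :
        polyEval r U V (U * V) (ι x) = ι (polyEval r S T (S * T) x) := by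
      simp only [polyEval, sum_apply, smul_apply,
        mul_apply_eq_comp, map_sum, map_smul]
      refine Finset.sum_congr rfl fun m _ => ?_
      rw [hpow (X := S * T) (fun x => by simp [hSU, hTV]), hpow hTV, hpow hSU]
    obtain ⟨u, hu⟩ := isUnit_polyEval h hS hT hq
    obtain ⟨v, hv⟩ := isUnit_polyEval hUV hU hV hq
    have hle := norm_polyEval_mul_inverse_le (p := p) hUV hU hV hUn hVn hq
    rw [← hv, Ring.inverse_unit] at hle
    rw [← hu, Ring.inverse_unit]
    -- An inverse need not preserve an invariant subspace; this one does because `q(S, T, S T)` is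
    -- already invertible on `H`.
    have hinv (x : H) : (↑v⁻¹ : K →L[ℂ] K) (ι x) = ι ((↑u⁻¹ : H →L[ℂ] H) x) := by
      have h1 : (u : H →L[ℂ] H) ((↑u⁻¹ : H →L[ℂ] H) x) = x := DFunLike.congr_fun u.mul_inv x
      have h2 (y : K) : (↑v⁻¹ : K →L[ℂ] K) ((v : K →L[ℂ] K) y) = y :=
        DFunLike.congr_fun v.inv_mul y
      conv_lhs => rw [← h1, hu, ← hpoly, ← hv, h2]
    refine ContinuousLinearMap.opNorm_le_bound _ (ratSup_nonneg p q) fun x => ?_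
    rw [mul_apply_eq_comp, ← ι.norm_map, ← hpoly, ← hinv, ← ι.norm_map x]
    exact ContinuousLinearMap.le_of_opNorm_le _ hle _

end SpectralSet

/-! ### Unitarity of the last entry of an `𝔼`-unitary. -/

section Unitary

variable {H : Type u} [NormedAddCommGroup H] [InnerProductSpace ℂ H] [CompleteSpace H]

/-- If the last Koszul map of `(A, B, P)` is onto, then `A A* + B B* + P P*` is invertible. -/
lemma isUnit_of_surjective_koszul₂ {A B P : H →L[ℂ] H}
    (h : Function.Surjective (koszul₂ A B P)) :
    IsUnit (A * star A + B * star B + P * star P) := by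
  -- Open mapping theorem: `y` has a preimage of norm at most `C ‖y‖`. Pairing its image with `y`
  -- moves the operators to adjoints and bounds these jointly from below.
  obtain ⟨C, hC, hpre⟩ := (koszul₂ A B P).exists_preimage_norm_le h
  have hbound (y : H) : ‖y‖ ≤ C * (‖star A y‖ + ‖star B y‖ + ‖star P y‖) := by
    obtain ⟨x, hx, hxC⟩ := hpre y
    have h1 : ‖x.2.2‖ ≤ C * ‖y‖ := (norm_snd_le x.2).trans ((norm_snd_le x).trans hxC)
    have h2 : ‖x.2.1‖ ≤ C * ‖y‖ := (norm_fst_le x.2).trans ((norm_snd_le x).trans hxC)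
    have h3 : ‖x.1‖ ≤ C * ‖y‖ := (norm_fst_le x).trans hxC
    have hinner (X : H →L[ℂ] H) (w : H) (hw : ‖w‖ ≤ C * ‖y‖) :
        ‖inner ℂ (X w) y‖ ≤ C * ‖y‖ * ‖star X y‖ := by
      rw [← ContinuousLinearMap.adjoint_inner_right, ← ContinuousLinearMap.star_eq_adjoint]
      exact (norm_inner_le_norm _ _).trans (by gcongr)
    have hself : ‖y‖ * ‖y‖ ≤ C * (‖star A y‖ + ‖star B y‖ + ‖star P y‖) * ‖y‖ := by
      rw [← inner_self_eq_norm_mul_norm (𝕜 := ℂ)]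
      refine (RCLike.re_le_norm _).trans ?_
      conv_lhs => enter [1, 2]; rw [← hx]
      rw [koszul₂_apply, inner_add_left, inner_sub_left]
      have := (norm_add_le _ _).trans (add_le_add_left (norm_sub_le _ _) _) |>.trans
        (add_le_add (add_le_add (hinner A _ h1) (hinner B _ h2)) (hinner P _ h3))
      exact this.trans_eq (by ring)
    rcases (norm_nonneg y).eq_or_lt with hy | hy
    · rw [← hy]
      positivity
    · exact le_of_mul_le_mul_right hself hy
  -- The `3` comes from `(a + b + c)² ≤ 3 (a² + b² + c²)`.
  have hc : 0 < (3 * C ^ 2)⁻¹ := by positivity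
  refine ContinuousLinearMap.isUnit_of_forall_le_norm_inner_map _ (c := ⟨_, hc.le⟩) hc fun y => ?_
  have hsq (X : H →L[ℂ] H) : RCLike.re (inner ℂ ((X * star X) y) y) = ‖star X y‖ ^ 2 := by
    rw [mul_apply_eq_comp, ← ContinuousLinearMap.adjoint_inner_right,
      ← ContinuousLinearMap.star_eq_adjoint, inner_self_eq_norm_sq]
  refine le_trans ?_ (RCLike.re_le_norm _)
  simp only [add_apply, inner_add_left, map_add, hsq]
  change ‖y‖ ^ 2 * (3 * C ^ 2)⁻¹ ≤ _
  rw [← div_eq_mul_inv, div_le_iff₀ (by positivity)]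
  calc ‖y‖ ^ 2 ≤ (C * (‖star A y‖ + ‖star B y‖ + ‖star P y‖)) ^ 2 := by gcongr; exact hbound y
    _ = C ^ 2 * (‖star A y‖ + ‖star B y‖ + ‖star P y‖) ^ 2 := by ring
    _ ≤ C ^ 2 * (3 * (‖star A y‖ ^ 2 + ‖star B y‖ ^ 2 + ‖star P y‖ ^ 2)) := by
        gcongr
        nlinarith [sq_nonneg (‖star A y‖ - ‖star B y‖), sq_nonneg (‖star A y‖ - ‖star P y‖),
          sq_nonneg (‖star B y‖ - ‖star P y‖)]
    _ = _ := by ring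

/-- The last operator of an `𝔼`-unitary is unitary. -/
lemma IsEUnitary.mem_unitary {A B P : H →L[ℂ] H} (h : IsEUnitary A B P) :
    P ∈ unitary (H →L[ℂ] H) := by
  obtain ⟨hc, hA, hB, hP, hσ⟩ := h
  obtain ⟨C, _, φ, hφ, hmem, hunit⟩ := exists_commCStarAlgebra_of_pairwise_commute (s := {A, B, P})
    (by
      obtain ⟨hAB, hAP, hBP⟩ := hc
      rintro a (rfl | rfl | rfl) b (rfl | rfl | rfl)
      exacts [rfl, hAB, hAP, hAB.symm, rfl, hBP, hAP.symm, hBP.symm, rfl])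
    (by rintro a (rfl | rfl | rfl) <;> assumption)
  obtain ⟨a, rfl⟩ := hmem A (.inl rfl)
  obtain ⟨b, rfl⟩ := hmem B (.inr (.inl rfl))
  obtain ⟨c, rfl⟩ := hmem P (.inr (.inr rfl))
  -- If `(χ a, χ b, χ c)` were outside the Taylor spectrum, the sum of the `X X*` over the shifted
  -- operators `X` would be invertible, also in `C`; but `χ` kills it.
  have hnorm (χ : characterSpace ℂ C) : ‖χ c‖ = 1 := by
    refine (hσ (a := ![χ a, χ b, χ c]) fun hK => ?_).2
    have hu := isUnit_of_surjective_koszul₂ hK.2.2.2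
    have hsub (x : C) (w : ℂ) : φ x - w • 1 = φ (x - w • 1) := by simp
    simp only [Matrix.cons_val, hsub, ← map_star, ← map_mul, ← map_add] at hu
    have hu' := (hunit _ hu).map χ
    simp at hu'
  have hone : star c * c = 1 := by
    refine (gelfandTransform_isometry C).injective (ContinuousMap.ext fun χ => ?_)
    rw [gelfandTransform_apply_apply, map_mul, map_star, map_one]
    simp [← Complex.normSq_eq_conj_mul_self, Complex.normSq_eq_norm_sq, hnorm]
  rw [Unitary.mem_iff, ← map_star, ← map_mul, ← map_mul, mul_comm c, hone, map_one]
  exact ⟨rfl, rfl⟩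

end Unitary
open Filter Topology

/-! ### Unitary extension of commuting isometries by a direct limit. -/

section Extension

variable {H : Type u} [NormedAddCommGroup H] [InnerProductSpace ℂ H]

/-- The sequences in `H` that are eventually orbits of `W`. -/
def orbitSubmodule (W : H →ₗᵢ[ℂ] H) : Submodule ℂ (ℕ → H) where
  carrier := {x | ∀ᶠ n in atTop, x (n + 1) = W (x n)}
  add_mem' hx hy := by
    filter_upwards [hx, hy] with n h1 h2
    simp [h1, h2]
  zero_mem' := by simp
  smul_mem' c x hx := by
    filter_upwards [hx] with n h
    simp [h]

/-- The sequences in `H` that are eventually orbits of the isometry `W`, with the inner product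
of their tails. Its completion is the direct limit of `H` along the iterates of `W`. -/
def OrbitSpace (W : H →ₗᵢ[ℂ] H) : Type u := orbitSubmodule W

namespace OrbitSpace

variable {W : H →ₗᵢ[ℂ] H}

instance : AddCommGroup (OrbitSpace W) := inferInstanceAs (AddCommGroup (orbitSubmodule W))

instance : Module ℂ (OrbitSpace W) := inferInstanceAs (Module ℂ (orbitSubmodule W))

instance : CoeFun (OrbitSpace W) fun _ => ℕ → H := ⟨Subtype.val⟩

lemma add_apply (x y : OrbitSpace W) (n : ℕ) : (x + y) n = x n + y n := rfl

lemma smul_apply (c : ℂ) (x : OrbitSpace W) (n : ℕ) : (c • x) n = c • x n := rfl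

lemma sub_apply (x y : OrbitSpace W) (n : ℕ) : (x - y) n = x n - y n := rfl

lemma eventually_succ (x : OrbitSpace W) : ∀ᶠ n in atTop, x (n + 1) = W (x n) := x.2

/-- The eventual value of `⟪x n, y n⟫`. -/
noncomputable def tailInner (x y : OrbitSpace W) : ℂ := limUnder atTop fun n => inner ℂ (x n) (y n)

/-- Once both sequences are orbits, `W` preserves their inner product, so the limit is attained. -/
lemma eventually_inner_eq (x y : OrbitSpace W) :
    ∀ᶠ n in atTop, inner ℂ (x n) (y n) = tailInner x y := by
  obtain ⟨N, hN⟩ := eventually_atTop.1 (x.eventually_succ.and y.eventually_succ)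
  have hconst : ∀ n ≥ N, inner ℂ (x n) (y n) = inner ℂ (x N) (y N) := fun n hn => by
    induction n, hn using Nat.le_induction with
    | base => rfl
    | succ n hn ih => rw [(hN n hn).1, (hN n hn).2, W.inner_map_map, ih]
  have hlim : tailInner x y = inner ℂ (x N) (y N) :=
    (tendsto_atTop_of_eventually_const hconst).limUnder_eq
  exact eventually_atTop.2 ⟨N, fun n hn => (hconst n hn).trans hlim.symm⟩

/-- The inner product of tails as a semi-inner product. -/
@[reducible]
noncomputable def innerCore (W : H →ₗᵢ[ℂ] H) : PreInnerProductSpace.Core ℂ (OrbitSpace W) where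
  inner := tailInner
  conj_inner_symm x y := by
    obtain ⟨n, h1, h2⟩ := ((eventually_inner_eq x y).and (eventually_inner_eq y x)).exists
    rw [← h1, ← h2, inner_conj_symm]
  re_inner_nonneg x := by
    obtain ⟨n, h⟩ := (eventually_inner_eq x x).exists
    rw [← h]
    exact inner_self_nonneg
  add_left x y z := by
    obtain ⟨n, h1, h2, h3⟩ := ((eventually_inner_eq (x + y) z).and
      ((eventually_inner_eq x z).and (eventually_inner_eq y z))).exists
    rw [← h1, ← h2, ← h3, add_apply, inner_add_left]
  smul_left x y c := by
    obtain ⟨n, h1, h2⟩ := ((eventually_inner_eq (c • x) y).and (eventually_inner_eq x y)).exists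
    rw [← h1, ← h2, smul_apply, inner_smul_left]

/-- Only a seminorm: sequences that eventually vanish have norm zero. The completion identifies them
with zero. -/
noncomputable instance : SeminormedAddCommGroup (OrbitSpace W) :=
  @InnerProductSpace.Core.toSeminormedAddCommGroup ℂ _ _ _ _ (innerCore W)

noncomputable instance : InnerProductSpace ℂ (OrbitSpace W) := .ofCore (innerCore W)

lemma eventually_norm_eq (x : OrbitSpace W) : ∀ᶠ n in atTop, ‖x n‖ = ‖x‖ := by
  filter_upwards [eventually_inner_eq x x] with n h
  rw [norm_eq_sqrt_re_inner (𝕜 := ℂ), norm_eq_sqrt_re_inner (𝕜 := ℂ), h]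
  rfl

lemma norm_eq_of_eventually {x y : OrbitSpace W} (h : ∀ᶠ n in atTop, ‖x n‖ = ‖y n‖) :
    ‖x‖ = ‖y‖ := by
  obtain ⟨n, h1, h2, h3⟩ := (h.and ((eventually_norm_eq x).and (eventually_norm_eq y))).exists
  rw [← h2, ← h3, h1]

lemma coe_eq_of_eventually {x y : OrbitSpace W} (h : ∀ᶠ n in atTop, x n = y n) :
    (x : UniformSpace.Completion (OrbitSpace W)) = y := by
  rw [← sub_eq_zero, ← UniformSpace.Completion.coe_sub, ← norm_eq_zero,
    UniformSpace.Completion.norm_coe]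
  obtain ⟨n, h1, h2⟩ := (h.and (eventually_norm_eq (x - y))).exists
  rw [← h2, sub_apply, h1, sub_self, norm_zero]

/-- The embedding of `H` that sends `x` to its orbit. -/
noncomputable def orbit (W : H →ₗᵢ[ℂ] H) : H →ₗᵢ[ℂ] OrbitSpace W where
  toFun x := ⟨fun n => (W ^ n) x, .of_forall fun n => DFunLike.congr_fun (pow_succ' W n) x⟩
  map_add' x y := Subtype.ext <| funext fun n => map_add (W ^ n) x y
  map_smul' c x := Subtype.ext <| funext fun n => map_smul (W ^ n) c x
  norm_map' x := by
    obtain ⟨n, h⟩ := (eventually_norm_eq (W := W)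
      ⟨fun n => (W ^ n) x, .of_forall fun n => DFunLike.congr_fun (pow_succ' W n) x⟩).exists
    exact h.symm.trans ((W ^ n).norm_map x)

/-- The termwise action of an isometry that commutes with `W`. -/
noncomputable def mapIsometry (X : H →ₗᵢ[ℂ] H) (h : Commute X W) :
    OrbitSpace W →ₗᵢ[ℂ] OrbitSpace W where
  toFun x := ⟨fun n => X (x n), by
    filter_upwards [x.eventually_succ] with n hn
    rw [hn]
    exact DFunLike.congr_fun h.eq (x n)⟩
  map_add' x y := Subtype.ext <| funext fun n => map_add X (x n) (y n)
  map_smul' c x := Subtype.ext <| funext fun n => map_smul X c (x n)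
  norm_map' x := norm_eq_of_eventually <| .of_forall fun n => X.norm_map (x n)

lemma mapIsometry_orbit (X : H →ₗᵢ[ℂ] H) (h : Commute X W) (x : H) :
    mapIsometry X h (orbit W x) = orbit W (X x) :=
  Subtype.ext <| funext fun n => DFunLike.congr_fun (h.pow_right n).eq x

/-- The right shift, which inverts the action of `W` up to sequences of norm zero. -/
def shift (x : OrbitSpace W) : OrbitSpace W :=
  -- Truncated subtraction repeats `x 0` at the start, which is harmless since only tails count.
  ⟨fun n => x (n - 1), by
    filter_upwards [(tendsto_sub_atTop_nat 1).eventually x.eventually_succ, eventually_ge_atTop 1]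
      with n hn h1
    rw [Nat.sub_add_cancel h1] at hn
    exact hn⟩

lemma eventually_map_shift (x : OrbitSpace W) : ∀ᶠ n in atTop, W (shift x n) = x n := by
  filter_upwards [(tendsto_sub_atTop_nat 1).eventually x.eventually_succ, eventually_ge_atTop 1]
    with n hn h1
  rw [Nat.sub_add_cancel h1] at hn
  exact hn.symm

end OrbitSpace

lemma mem_unitary_of_isometry_of_surjective {K : Type u} [NormedAddCommGroup K]
    [InnerProductSpace ℂ K] [CompleteSpace K] {U : K →L[ℂ] K} (hU : Isometry U)
    (hs : Function.Surjective U) : U ∈ unitary (K →L[ℂ] K) := by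
  have h : star U * U = 1 := (U.norm_map_iff_adjoint_comp_self).1
    ((AddMonoidHomClass.isometry_iff_norm U).1 hU)
  refine Unitary.mem_iff.2 ⟨h, ContinuousLinearMap.ext fun y => ?_⟩
  obtain ⟨x, rfl⟩ := hs y
  exact congrArg U (DFunLike.congr_fun h x)

open UniformSpace OrbitSpace in
/-- **Itô's theorem** for two operators: commuting isometries extend to commuting unitaries. -/
theorem exists_commuting_unitary_extension {S T : H →L[ℂ] H} (hS : Isometry S) (hT : Isometry T)
    (h : Commute S T) :
    ∃ (K : Type u) (_ : NormedAddCommGroup K) (_ : InnerProductSpace ℂ K) (_ : CompleteSpace K)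
      (ι : H →ₗᵢ[ℂ] K) (U V : K →L[ℂ] K), U ∈ unitary (K →L[ℂ] K) ∧ V ∈ unitary (K →L[ℂ] K) ∧
      Commute U V ∧ ∀ x, U (ι x) = ι (S x) ∧ V (ι x) = ι (T x) := by
  let s : H →ₗᵢ[ℂ] H := ⟨S, (AddMonoidHomClass.isometry_iff_norm S).1 hS⟩
  let t : H →ₗᵢ[ℂ] H := ⟨T, (AddMonoidHomClass.isometry_iff_norm T).1 hT⟩
  have hst : Commute s t := LinearIsometry.ext fun x => DFunLike.congr_fun h.eq x
  -- Making the product invertible makes both commuting factors invertible, so one direct limit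
  -- suffices.
  let W : H →ₗᵢ[ℂ] H := s * t
  have hsW : Commute s W := (Commute.refl s).mul_right hst
  have htW : Commute t W := hst.symm.mul_right (.refl t)
  let U := (mapIsometry s hsW).toContinuousLinearMap.completion
  let V := (mapIsometry t htW).toContinuousLinearMap.completion
  have hU (x : OrbitSpace W) : U x = (mapIsometry s hsW x : OrbitSpace W) :=
    ContinuousLinearMap.completion_apply_coe _ x
  have hV (x : OrbitSpace W) : V x = (mapIsometry t htW x : OrbitSpace W) :=
    ContinuousLinearMap.completion_apply_coe _ x
  have hUiso : Isometry U := (mapIsometry s hsW).isometry.completion_map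
  have hViso : Isometry V := (mapIsometry t htW).isometry.completion_map
  have hcomm (x : Completion (OrbitSpace W)) : U (V x) = V (U x) := by
    induction x using Completion.induction_on with
    | hp => exact isClosed_eq (by fun_prop) (by fun_prop)
    | ih x =>
      rw [hV, hU, hU, hV]
      exact coe_eq_of_eventually (.of_forall fun n => DFunLike.congr_fun hst.eq (x n))
  have hsurj : Function.Surjective (U ∘ V) := by
    -- The range of an isometry of a complete space is closed; shifts show that it contains the
    -- dense image of `OrbitSpace W`.
    rw [← Set.range_eq_univ, ← (hUiso.comp hViso).isClosedEmbedding.isClosed_range.closure_eq]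
    refine Dense.closure_eq (Completion.denseRange_coe.mono ?_)
    rintro _ ⟨x, rfl⟩
    refine ⟨(shift x : OrbitSpace W), ?_⟩
    rw [Function.comp_apply, hV, hU]
    exact coe_eq_of_eventually (eventually_map_shift x)
  have hUs : Function.Surjective U := hsurj.of_comp
  have hVs : Function.Surjective V := by
    rw [show U ∘ V = V ∘ U from funext hcomm] at hsurj
    exact hsurj.of_comp
  refine ⟨Completion (OrbitSpace W), inferInstance, inferInstance, inferInstance,
    Completion.toComplₗᵢ.comp (orbit W), U, V, mem_unitary_of_isometry_of_surjective hUiso hUs,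
    mem_unitary_of_isometry_of_surjective hViso hVs, ContinuousLinearMap.ext hcomm,
    fun x => ⟨?_, ?_⟩⟩
  · exact (hU _).trans (congrArg _ (mapIsometry_orbit s hsW x))
  · exact (hV _).trans (congrArg _ (mapIsometry_orbit t htW x))

end Extension
-- From unitaries and isometries to `𝔼`-unitaries and `𝔼`-isometries, and back.
section Main

variable {H : Type u} [NormedAddCommGroup H] [InnerProductSpace ℂ H]

lemma isEUnitary_of_mem_unitary [CompleteSpace H] {S T : H →L[ℂ] H}
    (hS : S ∈ unitary (H →L[ℂ] H)) (hT : T ∈ unitary (H →L[ℂ] H)) (h : Commute S T) :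
    IsEUnitary S T (S * T) := by
  have normal {X : H →L[ℂ] H} (hX : X ∈ unitary (H →L[ℂ] H)) : IsStarNormal X :=
    ⟨(Unitary.star_mul_self_of_mem hX).trans (Unitary.mul_star_self_of_mem hX).symm⟩
  refine ⟨commutingTriple_mul h, normal hS, normal hT, normal (mul_mem hS hT), fun z hz => ?_⟩
  obtain ⟨h0, h1, h2⟩ := mem_spectrum_of_mem_taylorSpectrum_mul h hz
  have n0 : ‖z 0‖ = 1 := by simpa using spectrum.subset_circle_of_unitary hS h0
  have n1 : ‖z 1‖ = 1 := by simpa using spectrum.subset_circle_of_unitary hT h1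
  refine ⟨?_, by rw [h2, norm_mul, n0, n1, one_mul]⟩
  have hz' : z = ![z 0, z 1, z 0 * z 1] := by
    ext i
    fin_cases i <;> simp [h2]
  rw [hz']
  exact mem_closedTetrablock_of_norm_le_one n0.le n1.le

lemma norm_le_one_of_isometry {S : H →L[ℂ] H} (hS : Isometry S) : ‖S‖ ≤ 1 :=
  ContinuousLinearMap.opNorm_le_bound _ zero_le_one fun x => by
    rw [(AddMonoidHomClass.isometry_iff_norm S).1 hS, one_mul]

lemma isometry_of_mem_unitary [CompleteSpace H] {U : H →L[ℂ] H} (hU : U ∈ unitary (H →L[ℂ] H)) :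
    Isometry U :=
  (AddMonoidHomClass.isometry_iff_norm U).2 <|
    U.norm_map_iff_adjoint_comp_self.2 (Unitary.star_mul_self_of_mem hU)

/-- A contraction `T` such that `S T` is isometric for some contraction `S` is isometric. -/
lemma isometry_of_isometry_mul {S T : H →L[ℂ] H} (hS : ‖S‖ ≤ 1) (hT : ‖T‖ ≤ 1)
    (h : Isometry (S * T)) : Isometry T := by
  refine (AddMonoidHomClass.isometry_iff_norm T).2 fun x =>
    le_antisymm (by simpa using T.le_of_opNorm_le hT x) ?_
  rw [← (AddMonoidHomClass.isometry_iff_norm _).1 h x]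
  simpa using S.le_of_opNorm_le hS (T x)

lemma isEContraction_of_isometry [CompleteSpace H] {S T : H →L[ℂ] H} (hS : Isometry S)
    (hT : Isometry T) (h : Commute S T) : IsEContraction S T (S * T) := by
  obtain ⟨K, _, _, _, ι, U, V, hU, hV, hUV, hι⟩ := exists_commuting_unitary_extension hS hT h
  have hE := isEUnitary_of_mem_unitary hU hV hUV
  exact isEContraction_of_extension ι h (norm_le_one_of_isometry hS) (norm_le_one_of_isometry hT)
    hUV (norm_le_one_of_isometry (isometry_of_mem_unitary hU))
    (norm_le_one_of_isometry (isometry_of_mem_unitary hV)) hE.2.1 hE.2.2.1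
    (fun x => (hι x).1) (fun x => (hι x).2)

lemma isEIsometry_of_isometry {S T : H →L[ℂ] H} (hS : Isometry S) (hT : Isometry T)
    (h : Commute S T) : IsEIsometry S T (S * T) := by
  obtain ⟨K, _, _, _, ι, U, V, hU, hV, hUV, hι⟩ := exists_commuting_unitary_extension hS hT h
  refine ⟨commutingTriple_mul h, K, _, _, inferInstance, ι, U, V, U * V,
    isEUnitary_of_mem_unitary hU hV hUV, fun x => ⟨(hι x).1, (hι x).2, ?_⟩⟩
  rw [mul_apply_eq_comp, (hι x).2, (hι (T x)).1]
  rfl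

lemma IsEIsometry.isometry {A B P : H →L[ℂ] H} (h : IsEIsometry A B P) : Isometry P := by
  obtain ⟨-, K, _, _, _, ι, Q₁, Q₂, V, hV, hι⟩ := h
  refine (AddMonoidHomClass.isometry_iff_norm P).2 fun x => ?_
  rw [← ι.norm_map, ← (hι x).2.2, ← ι.norm_map x]
  exact (AddMonoidHomClass.isometry_iff_norm V).1 (isometry_of_mem_unitary hV.mem_unitary) _

end Main

end Tetrablock

theorem lemma3 {H : Type u} [NormedAddCommGroup H] [InnerProductSpace ℂ H] [CompleteSpace H]
    (A B P : H →L[ℂ] H) (hcomm : Tetrablock.CommutingTriple A B P)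
    (hA : ‖A‖ ≤ 1) (hB : ‖B‖ ≤ 1) (hP : ‖P‖ ≤ 1) :
    (Tetrablock.IsTriangularEUnitary A B P ↔
      ∃ S T : H →L[ℂ] H, S ∈ unitary (H →L[ℂ] H) ∧ T ∈ unitary (H →L[ℂ] H) ∧ Commute S T ∧
        (A, B, P) = (S, T, S * T)) ∧
    (Tetrablock.IsTriangularEIsometry A B P ↔
      ∃ S T : H →L[ℂ] H, Isometry S ∧ Isometry T ∧ Commute S T ∧
        (A, B, P) = (S, T, S * T)) := by
  open Tetrablock in
  refine ⟨⟨?_, ?_⟩, ?_, ?_⟩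
  · rintro ⟨-, hE, S, T, h, hS, hT, heq⟩
    obtain ⟨rfl, rfl, rfl⟩ : A = S ∧ B = T ∧ P = S * T := by simpa using heq
    have hU := hE.mem_unitary
    have hST := isometry_of_mem_unitary hU
    -- An isometric product controls its right factor and a surjective one its left factor, so both
    -- orders are needed.
    have hTS : Isometry (B * A) := h.eq ▸ hST
    have hsurj : Function.Surjective (A * B : H →L[ℂ] H) := fun y =>
      ⟨_, DFunLike.congr_fun (Unitary.mul_star_self_of_mem hU) y⟩
    have hsurj' : Function.Surjective (B * A : H →L[ℂ] H) := h.eq ▸ hsurj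
    exact ⟨A, B, mem_unitary_of_isometry_of_surjective (isometry_of_isometry_mul hT hS hTS)
      (Function.Surjective.of_comp (g := B) hsurj), mem_unitary_of_isometry_of_surjective
      (isometry_of_isometry_mul hS hT hST) (Function.Surjective.of_comp (g := A) hsurj'), h, rfl⟩
  · rintro ⟨S, T, hS, hT, h, heq⟩
    obtain ⟨rfl, rfl, rfl⟩ : A = S ∧ B = T ∧ P = S * T := by simpa using heq
    exact ⟨isEContraction_of_isometry (isometry_of_mem_unitary hS) (isometry_of_mem_unitary hT) h,
      isEUnitary_of_mem_unitary hS hT h, A, B, h, hA, hB, rfl⟩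
  · rintro ⟨-, hE, S, T, h, hS, hT, heq⟩
    obtain ⟨rfl, rfl, rfl⟩ : A = S ∧ B = T ∧ P = S * T := by simpa using heq
    have hST := hE.isometry
    have hTS : Isometry (B * A) := h.eq ▸ hST
    exact ⟨A, B, isometry_of_isometry_mul hT hS hTS, isometry_of_isometry_mul hS hT hST, h, rfl⟩
  · rintro ⟨S, T, hS, hT, h, heq⟩
    obtain ⟨rfl, rfl, rfl⟩ : A = S ∧ B = T ∧ P = S * T := by simpa using heq
    exact ⟨isEContraction_of_isometry hS hT h, isEIsometry_of_isometry hS hT h, A, B, h, hA, hB,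
      rfl⟩
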